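/- **Setting.** Let $\mathcal G$ be a directed graph on the followers $\{1,\dots,N\}$ without self-loops or repeated edges; put $a_{ij}=1$ if there is an edge $(j,i)$ (node $i$ obtains information from its neighbor $j$, $j\in N_i$) and $a_{ij}=0$ otherwise. Let $\mathcal L=\mathrm{diag}\{\sum_j a_{ij}\}-[a_{ij}]$ be its Laplacian, let $g_i=1$ if follower $i$ observes the leader (is pinned) and $g_i=0$ otherwise, and $G=\mathrm{diag}\{g_1,\dots,g_N\}$. Assume that $\mathcal G$ contains a spanning tree rooted at a pinned node. Then there are diagonal matrices $\Theta=\mathrm{diag}\{\vartheta_1,\dots,\vartheta_N\}$ with $\vartheta_i>0$ such that $H=\Theta^{-1}(\mathcal L+G)+(\mathcal L+G)'\Theta^{-1}>0$; fix any such $\Theta$ and let $\alpha=\frac12\lambda_{\min}(H)$, $\vartheta_{\min}=\min_i\vartheta_i$, $\underline\vartheta=\min_i\vartheta_i^{-1}$, $P=\Theta^{-1}(\mathcal L+G)(\mathcal L+G)'\Theta^{-1}$, $F=(\mathcal L+G)'(\mathcal L+G)$. The leader and the followers have the dynamics $\dot x_0=Ax_0$, $\dot x_i=Ax_i+Bu_i$,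 with $A\in\mathbb R^{n\times n}$, $B\in\mathbb R^{n\times p}$, $n\ge1$. Put $z_i(t)=\sum_{j\in N_i}(x_j(t)-x_i(t))+g_i(x_0(t)-x_i(t))$. Agent $i$ has event times $0=t^i_0<t^i_1<\cdots$ (finitely or infinitely many), applies $u_i(t)=-K\hat z_i(t)$ with $\hat z_i(t)=z_i(t^i_k)$ for $t\in[t^i_k,t^i_{k+1})$, and its measurement error is $s_i(t)=z_i(t^i_k)-z_i(t)$ until the next event. **Theorem.** Let $R=R'>0$, $Q=Q'>0$, and suppose $Y=Y'>0$ satisfies $$YA+A'Y-2\vartheta_{\min}YBR^{-1}B'Y+Q\le0.$$ Let $\alpha_1=\lambda_{\min}(Q)/\lambda_{\max}(Y)$ and $\alpha_2=\lambda_{\max}(P)\,\lambda_{\max}^2(YBR^{-1}B'Y)/(\underline\vartheta\,\lambda_{\min}(Y))$. Let $\omega>0$ and $\mu_i>0$ be such that $\rho_i=\alpha_1-\mu_i-\frac{\omega}{\alpha}\alpha_2>0$ for all $i$, let $\rho_{\min}=\min_i\rho_i$, and let $\nu_i>0$, $\sigma_i\in(0,\rho_{\min})$, $\gamma>0$. Let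 $K=-\frac1\alpha R^{-1}B'Y$, and let events be triggered at $$t^i_k=\inf\{t>t^i_{k-1}:\ \|s_i(t)\|^2\ge\alpha\omega(\mu_i\vartheta_i^{-1}z_i(t)'Yz_i(t)+\nu_ie^{-\sigma_it}+\gamma)\}$$ (no $k$-th event if the set is empty). Then, along every trajectory of the closed-loop system, followed up to the first accumulation point of event times, if there is one: 1. there is $\delta>0$ with $t^i_{k+1}-t^i_k\ge\delta$ for all agents $i$ and all of their consecutive events, so there is no Zeno behavior: the events do not accumulate and the trajectory is followed for all $t\ge0$; 2. $$\limsup_{t\to\infty}\sum_{i=1}^N\|x_0(t)-x_i(t)\|^2\le\frac{N\gamma}{\underline\vartheta\,\lambda_{\min}(Y)\,\lambda_{\min}(F)\,\rho_{\min}}.$$ -/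

import Mathlib

open scoped Matrix

noncomputable section

namespace EventTracking

/-- Smallest eigenvalue of a real symmetric matrix. -/
def lambdaMin {m : Type*} [Fintype m] [DecidableEq m] (M : Matrix m m ℝ) : ℝ :=
  sInf (spectrum ℝ M)

/-- Largest eigenvalue of a real symmetric matrix. -/
def lambdaMax {m : Type*} [Fintype m] [DecidableEq m] (M : Matrix m m ℝ) : ℝ :=
  sSup (spectrum ℝ M)

/-- `T` is a spanning tree of the directed graph `E`, rooted at `r`: a subgraph in which `r` has no
parent, every other node has exactly one parent, and every node is reached from `r` along directed
edges. -/
structure IsSpanningTree {V : Type*} (E T : Digraph V) (r : V) : Prop where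
  sub : T ≤ E
  root : ∀ j, ¬ T.Adj j r
  parent : ∀ v, v ≠ r → ∃! j, T.Adj j v
  reach : ∀ v, Relation.ReflTransGen T.Adj r v

/-- Communication graph of `N` followers and a leader: the directed follower graph, without
self-loops (`graph.Adj j i` means that `i` obtains information from `j`), and the set of pinned
followers, i.e. those that observe the leader. -/
structure Network (N : ℕ) where
  graph : Digraph (Fin N)
  loopless : ∀ i, ¬ graph.Adj i i
  pinned : Set (Fin N)

namespace Network

variable {N : ℕ} (net : Network N)

/-- The follower graph contains a spanning tree rooted at a pinned node. -/
def HasPinnedSpanningTree : Prop :=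
  ∃ r ∈ net.pinned, ∃ T : Digraph (Fin N), IsSpanningTree net.graph T r

open Classical in
/-- The neighbours of `i`. -/
def neighbors (i : Fin N) : Finset (Fin N) :=
  Finset.univ.filter fun j => net.graph.Adj j i

open Classical in
/-- Adjacency matrix `𝒜`, with `a i j = 1` when there is an edge from `j` to `i`. -/
def adj : Matrix (Fin N) (Fin N) ℝ :=
  Matrix.of fun i j => if net.graph.Adj j i then 1 else 0

/-- Laplacian `ℒ = 𝒟 - 𝒜`, where `𝒟` is the diagonal matrix of in-degrees. -/
def laplacian : Matrix (Fin N) (Fin N) ℝ :=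
  Matrix.diagonal (fun i => ∑ j, net.adj i j) - net.adj

open Classical in
/-- Pinning weights `g i`. -/
def pin (i : Fin N) : ℝ := if i ∈ net.pinned then 1 else 0

/-- The matrix `ℒ + G`. -/
def coupling : Matrix (Fin N) (Fin N) ℝ :=
  net.laplacian + Matrix.diagonal net.pin

/-- `H = Θ⁻¹ (ℒ + G) + (ℒ + G)' Θ⁻¹` with `Θ = diag ϑ`. -/
def matH (ϑ : Fin N → ℝ) : Matrix (Fin N) (Fin N) ℝ :=
  (Matrix.diagonal ϑ)⁻¹ * net.coupling + net.couplingᵀ * (Matrix.diagonal ϑ)⁻¹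

/-- `P = Θ⁻¹ (ℒ + G) (ℒ + G)' Θ⁻¹` with `Θ = diag ϑ`. -/
def matP (ϑ : Fin N → ℝ) : Matrix (Fin N) (Fin N) ℝ :=
  (Matrix.diagonal ϑ)⁻¹ * net.coupling * net.couplingᵀ * (Matrix.diagonal ϑ)⁻¹

/-- `F = (ℒ + G)' (ℒ + G)`. -/
def matF : Matrix (Fin N) (Fin N) ℝ :=
  net.couplingᵀ * net.coupling

/-- `α = λ_min(H) / 2`. -/
def alpha (ϑ : Fin N → ℝ) : ℝ := 1 / 2 * lambdaMin (net.matH ϑ)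

/-- The combinational state
`z_i = ∑_{j ∈ N_i} (x_j - x_i) + g_i (x_0 - x_i)` at time `t`. -/
def combState {n : ℕ} (x₀ : ℝ → EuclideanSpace ℝ (Fin n))
    (x : Fin N → ℝ → EuclideanSpace ℝ (Fin n)) (i : Fin N) (t : ℝ) :
    EuclideanSpace ℝ (Fin n) :=
  ∑ j ∈ net.neighbors i, (x j t - x i t) + net.pin i • (x₀ t - x i t)

end Network

variable {N n p : ℕ}

/-- `Y B R⁻¹ B' Y`. -/
def matS (B : Matrix (Fin n) (Fin p) ℝ) (R : Matrix (Fin p) (Fin p) ℝ)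
    (Y : Matrix (Fin n) (Fin n) ℝ) : Matrix (Fin n) (Fin n) ℝ :=
  Y * B * R⁻¹ * Bᵀ * Y

/-- The Riccati inequality `Y A + A' Y - 2 ϑ_min Y B R⁻¹ B' Y + Q ≤ 0`. -/
def Riccati (A : Matrix (Fin n) (Fin n) ℝ) (B : Matrix (Fin n) (Fin p) ℝ)
    (R : Matrix (Fin p) (Fin p) ℝ) (Q Y : Matrix (Fin n) (Fin n) ℝ) (ϑ : Fin N → ℝ) : Prop :=
  (-(Y * A + Aᵀ * Y - (2 * ⨅ i, ϑ i) • matS B R Y + Q)).PosSemidef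

/-- The feedback gain `K = -(1/α) R⁻¹ B' Y`. -/
def gain (net : Network N) (B : Matrix (Fin n) (Fin p) ℝ) (R : Matrix (Fin p) (Fin p) ℝ)
    (Y : Matrix (Fin n) (Fin n) ℝ) (ϑ : Fin N → ℝ) : Matrix (Fin p) (Fin n) ℝ :=
  (-(1 / net.alpha ϑ)) • (R⁻¹ * Bᵀ * Y)

/-- `α₁ = λ_min(Q) / λ_max(Y)`. -/
def alpha₁ (Q Y : Matrix (Fin n) (Fin n) ℝ) : ℝ := lambdaMin Q / lambdaMax Y

/-- `α₂ = λ_max(P) λ_max(Y B R⁻¹ B' Y)² / (min_i ϑ_i⁻¹ · λ_min(Y))`. -/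
def alpha₂ (net : Network N) (B : Matrix (Fin n) (Fin p) ℝ) (R : Matrix (Fin p) (Fin p) ℝ)
    (Y : Matrix (Fin n) (Fin n) ℝ) (ϑ : Fin N → ℝ) : ℝ :=
  lambdaMax (net.matP ϑ) * lambdaMax (matS B R Y) ^ 2 / ((⨅ i, (ϑ i)⁻¹) * lambdaMin Y)

/-- `ρ_i = α₁ - μ_i - (ω / α) α₂`. -/
def rho (net : Network N) (B : Matrix (Fin n) (Fin p) ℝ) (R : Matrix (Fin p) (Fin p) ℝ)
    (Q Y : Matrix (Fin n) (Fin n) ℝ) (ϑ : Fin N → ℝ) (ω : ℝ) (μ : Fin N → ℝ) (i : Fin N) : ℝ :=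
  alpha₁ Q Y - μ i - ω / net.alpha ϑ * alpha₂ net B R Y ϑ

/-- The right-hand side `α ω (μ_i ϑ_i⁻¹ z' Y z + ν_i e^{-σ_i t} + γ)` of the triggering condition
of agent `i`, as a function of time and of the combinational state. -/
def triggerLevel (net : Network N) (Y : Matrix (Fin n) (Fin n) ℝ) (ϑ : Fin N → ℝ) (ω : ℝ)
    (μ ν σ : Fin N → ℝ) (γ : ℝ) (i : Fin N) (t : ℝ) (z : EuclideanSpace ℝ (Fin n)) : ℝ :=
  net.alpha ϑ * ω *
    (μ i * (ϑ i)⁻¹ * inner ℝ z (Matrix.toEuclideanLin Y z) + ν i * Real.exp (-σ i * t) + γ)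

/-- End of the time interval on which a family of event times `τ i k` determines the held signals:
the first instant at which the events of some agent accumulate, and `⊤` when there is none.
The value `τ i k = ⊤` means that agent `i` has no `k`-th event. -/
def horizon (τ : Fin N → ℕ → EReal) : EReal := ⨅ i, ⨆ k, τ i k

/-- `x₀`, `x` and `τ` form a run of the event-triggered closed loop, started at time `0` and
followed up to the first accumulation of events (which is not excluded by this definition).
Each state is continuous, and at every instant its right derivative is the right-hand side of its
differential equation, where agent `i` holds `z_i(τ i k)` on `[τ i k, τ i (k+1))`. The next event
of agent `i` is the first later time at which the squared norm of the measurement error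
`z_i(τ i k) - z_i(t)` reaches the prescribed level; it is `⊤` when there is no such time. -/
structure IsRun (net : Network N) (A : Matrix (Fin n) (Fin n) ℝ) (B : Matrix (Fin n) (Fin p) ℝ)
    (K : Matrix (Fin p) (Fin n) ℝ) (level : Fin N → ℝ → EuclideanSpace ℝ (Fin n) → ℝ)
    (x₀ : ℝ → EuclideanSpace ℝ (Fin n)) (x : Fin N → ℝ → EuclideanSpace ℝ (Fin n))
    (τ : Fin N → ℕ → EReal) : Prop where
  leader_continuous : ContinuousOn x₀ {t : ℝ | 0 ≤ t ∧ (t : EReal) < horizon τ}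
  leader_deriv : ∀ t : ℝ, 0 ≤ t → (t : EReal) < horizon τ →
    HasDerivWithinAt x₀ (Matrix.toEuclideanLin A (x₀ t)) (Set.Ici t) t
  follower_continuous : ∀ i, ContinuousOn (x i) {t : ℝ | 0 ≤ t ∧ (t : EReal) < horizon τ}
  follower_deriv : ∀ (i : Fin N) (k : ℕ) (t : ℝ),
    τ i k ≤ (t : EReal) → (t : EReal) < τ i (k + 1) → (t : EReal) < horizon τ →
    HasDerivWithinAt (x i)
      (Matrix.toEuclideanLin A (x i t) +
        Matrix.toEuclideanLin B
          (-Matrix.toEuclideanLin K (net.combState x₀ x i (τ i k).toReal)))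
      (Set.Ici t) t
  event_zero : ∀ i, τ i 0 = 0
  event_succ : ∀ (i : Fin N) (k : ℕ), τ i (k + 1) =
    sInf {s : EReal | ∃ t : ℝ, s = (t : EReal) ∧ τ i k < (t : EReal) ∧ (t : EReal) < horizon τ ∧
      level i t (net.combState x₀ x i t) ≤
        ‖net.combState x₀ x i (τ i k).toReal - net.combState x₀ x i t‖ ^ 2}

end EventTracking

end

/-! Write z = ((ℒ+G)⊗I)(x₀ − x), S = YBR⁻¹B'Y and V = ∑ ϑᵢ⁻¹ zᵢ'Yzᵢ. Since λ_min(H) = 2α and the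
gain carries 1/α, the coupling contributes at most −2∑ zᵢ'Szᵢ to V'. This absorbs the S-term of the
Riccati inequality, and Q leaves −α₁V. Young's inequality with weight ω splits the cross term with
the errors into (ω/α)α₂V and ∑‖sⱼ‖²/(αω), and the trigger controls the latter. Hence V' ≤ −ρ_min V +
Nγ + ∑ νᵢe^{−σᵢt} (`lyapunov_deriv_le_of_trigger`), so V stays below an explicit solution that tends
to Nγ/ρ_min (`le_comparison`).

The estimate is valid up to the first accumulation of events and bounds V independently of that
time. There z, the held values and z' are bounded, while an error starts at 0 and must reach norm
√(αωγ) before the next event. The gaps are therefore bounded below and the horizon is infinite. The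
limit of the bound on V passes to the tracking errors through λ_min(Y) and λ_min(F).

The existence of Θ is M-matrix theory: a minimum principle along the tree makes ℒ+G invertible with
nonnegative inverse, from which Θ is read off (`exists_matH_posDef`). -/

open scoped Matrix

noncomputable section

namespace EventTracking

/-! ### Quadratic forms of symmetric matrices on families of vectors -/

section SpectralBounds

variable {m k : Type*} [Fintype m] [DecidableEq m] [Fintype k] [DecidableEq k]

theorem spectrum_nonempty_of_isHermitian [Nonempty m] {M : Matrix m m ℝ} (hM : M.IsHermitian) :
    (spectrum ℝ M).Nonempty :=
  ⟨_, hM.eigenvalues_mem_spectrum_real (Classical.arbitrary m)⟩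

theorem posSemidef_sub_lambdaMin {M : Matrix m m ℝ} (hM : M.IsHermitian) :
    (M - lambdaMin M • (1 : Matrix m m ℝ)).PosSemidef := by
  rw [Matrix.posSemidef_iff_isHermitian_and_spectrum_nonneg]
  refine ⟨hM.sub ((Matrix.isHermitian_one).smul (by simp [isSelfAdjoint_iff])), ?_⟩
  intro a ha
  rw [← Algebra.algebraMap_eq_smul_one, ← spectrum.sub_singleton_eq] at ha
  obtain ⟨b, hb, c, rfl, rfl⟩ := ha
  exact sub_nonneg.2 (csInf_le Matrix.finite_real_spectrum.bddBelow hb)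

theorem posSemidef_lambdaMax_sub {M : Matrix m m ℝ} (hM : M.IsHermitian) :
    (lambdaMax M • (1 : Matrix m m ℝ) - M).PosSemidef := by
  rw [Matrix.posSemidef_iff_isHermitian_and_spectrum_nonneg]
  refine ⟨((Matrix.isHermitian_one).smul (by simp [isSelfAdjoint_iff])).sub hM, ?_⟩
  intro a ha
  rw [← Algebra.algebraMap_eq_smul_one, ← spectrum.singleton_sub_eq] at ha
  obtain ⟨c, rfl, b, hb, rfl⟩ := ha
  exact sub_nonneg.2 (le_csSup Matrix.finite_real_spectrum.bddAbove hb)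

theorem lambdaMin_pos [Nonempty m] {M : Matrix m m ℝ} (hM : M.PosDef) : 0 < lambdaMin M := by
  have h := (spectrum_nonempty_of_isHermitian hM.1).csInf_mem Matrix.finite_real_spectrum
  rw [hM.1.spectrum_real_eq_range_eigenvalues] at h
  obtain ⟨i, hi⟩ := h
  have := hM.eigenvalues_pos i
  rw [lambdaMin, hM.1.spectrum_real_eq_range_eigenvalues]
  linarith

theorem lambdaMax_nonneg {M : Matrix m m ℝ} (hM : M.PosSemidef) : 0 ≤ lambdaMax M := by
  refine Real.sSup_nonneg ?_
  exact (Matrix.posSemidef_iff_isHermitian_and_spectrum_nonneg.1 hM).2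

theorem lambdaMin_le_lambdaMax [Nonempty m] {M : Matrix m m ℝ} (hM : M.IsHermitian) :
    lambdaMin M ≤ lambdaMax M :=
  csInf_le_csSup (spectrum_nonempty_of_isHermitian hM) Matrix.finite_real_spectrum.bddBelow
    Matrix.finite_real_spectrum.bddAbove

theorem exists_eq_transpose_mul_self {M : Matrix m m ℝ} (hM : M.PosSemidef) :
    ∃ C : Matrix m m ℝ, M = Cᵀ * C := by
  open scoped MatrixOrder in
  obtain ⟨C, hC⟩ := CStarAlgebra.nonneg_iff_eq_star_mul_self.1 hM.nonneg
  exact ⟨C, by simpa [Matrix.star_eq_conjTranspose] using hC⟩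

theorem inner_toEuclideanLin (M : Matrix m k ℝ) (x : EuclideanSpace ℝ k)
    (y : EuclideanSpace ℝ m) :
    inner ℝ (Matrix.toEuclideanLin M x) y = inner ℝ x (Matrix.toEuclideanLin Mᵀ y) := by
  simp only [EuclideanSpace.inner_eq_star_dotProduct, Matrix.ofLp_toLpLin, Matrix.toLin'_apply,
    star_trivial]
  rw [dotProduct_comm, Matrix.mulVec_transpose, ← Matrix.dotProduct_mulVec,
    dotProduct_comm]

theorem toEuclideanLin_mul {l : Type*} [Fintype l] [DecidableEq l] (M : Matrix m k ℝ)
    (M' : Matrix k l ℝ) (x : EuclideanSpace ℝ l) :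
    Matrix.toEuclideanLin (M * M') x = Matrix.toEuclideanLin M (Matrix.toEuclideanLin M' x) := by
  simp

theorem toEuclideanLin_one (x : EuclideanSpace ℝ m) :
    Matrix.toEuclideanLin (1 : Matrix m m ℝ) x = x := by
  simp

/-- `∑ⱼ ‖∑ᵢ Lᵢⱼ uᵢ‖² = ∑ᵢₗ (L Lᵀ)ᵢₗ ⟪uᵢ, uₗ⟫`. -/
theorem sum_norm_sq_sum_smul {E : Type*} [NormedAddCommGroup E] [InnerProductSpace ℝ E]
    (L : Matrix m k ℝ) (u : m → E) :
    ∑ j, ‖∑ i, L i j • u i‖ ^ 2 = ∑ i, ∑ l, (L * Lᵀ) i l * inner ℝ (u i) (u l) := by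
  simp only [← real_inner_self_eq_norm_sq, sum_inner, inner_sum, real_inner_smul_left,
    real_inner_smul_right, Matrix.mul_apply, Matrix.transpose_apply, Finset.sum_mul]
  rw [Finset.sum_comm]
  refine Finset.sum_congr rfl fun i _ => ?_
  rw [Finset.sum_comm]
  exact Finset.sum_congr rfl fun l _ => Finset.sum_congr rfl fun j _ => by
    rw [real_inner_comm]; ring

/-- Factoring G = CᵀC turns the double sum into a sum of squared norms. This plays the role of
positivity of G ⊗ I. -/
theorem sum_mul_inner_nonneg {E : Type*} [NormedAddCommGroup E] [InnerProductSpace ℝ E]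
    {G : Matrix m m ℝ} (hG : G.PosSemidef) (u : m → E) :
    0 ≤ ∑ i, ∑ j, G i j * inner ℝ (u i) (u j) := by
  obtain ⟨C, rfl⟩ := exists_eq_transpose_mul_self hG
  have h := sum_norm_sq_sum_smul Cᵀ u
  rw [Matrix.transpose_transpose] at h
  rw [← h]
  positivity

theorem lambdaMin_mul_sum_le {E : Type*} [NormedAddCommGroup E] [InnerProductSpace ℝ E]
    {G : Matrix m m ℝ} (hG : G.IsHermitian) (u : m → E) :
    lambdaMin G * ∑ i, ‖u i‖ ^ 2 ≤ ∑ i, ∑ j, G i j * inner ℝ (u i) (u j) := by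
  have h := sum_mul_inner_nonneg (posSemidef_sub_lambdaMin hG) u
  simp only [Matrix.sub_apply, Matrix.smul_apply, Matrix.one_apply, sub_mul,
    Finset.sum_sub_distrib, smul_eq_mul, mul_ite, ite_mul, mul_one, mul_zero, zero_mul,
    Finset.sum_ite_eq, Finset.mem_univ, if_true, real_inner_self_eq_norm_sq,
    ← Finset.mul_sum] at h
  linarith

theorem sum_le_lambdaMax_mul {E : Type*} [NormedAddCommGroup E] [InnerProductSpace ℝ E]
    {G : Matrix m m ℝ} (hG : G.IsHermitian) (u : m → E) :
    ∑ i, ∑ j, G i j * inner ℝ (u i) (u j) ≤ lambdaMax G * ∑ i, ‖u i‖ ^ 2 := by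
  have h := sum_mul_inner_nonneg (posSemidef_lambdaMax_sub hG) u
  simp only [Matrix.sub_apply, Matrix.smul_apply, Matrix.one_apply, sub_mul,
    Finset.sum_sub_distrib, smul_eq_mul, mul_ite, ite_mul, mul_one, mul_zero, zero_mul,
    Finset.sum_ite_eq, Finset.mem_univ, if_true, real_inner_self_eq_norm_sq,
    ← Finset.mul_sum] at h
  linarith

theorem inner_toEuclideanLin_nonneg {M : Matrix m m ℝ} (hM : M.PosSemidef)
    (z : EuclideanSpace ℝ m) : 0 ≤ inner ℝ z (Matrix.toEuclideanLin M z) := by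
  obtain ⟨C, rfl⟩ := exists_eq_transpose_mul_self hM
  rw [toEuclideanLin_mul, ← inner_toEuclideanLin]
  exact real_inner_self_nonneg

theorem lambdaMin_mul_norm_sq_le {M : Matrix m m ℝ} (hM : M.IsHermitian)
    (z : EuclideanSpace ℝ m) :
    lambdaMin M * ‖z‖ ^ 2 ≤ inner ℝ z (Matrix.toEuclideanLin M z) := by
  have h := inner_toEuclideanLin_nonneg (posSemidef_sub_lambdaMin hM) z
  simp only [map_sub, map_smul, LinearMap.sub_apply, LinearMap.smul_apply, toEuclideanLin_one,
    inner_sub_right, real_inner_smul_right, real_inner_self_eq_norm_sq] at h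
  linarith

theorem inner_le_lambdaMax_mul_norm_sq {M : Matrix m m ℝ} (hM : M.IsHermitian)
    (z : EuclideanSpace ℝ m) :
    inner ℝ z (Matrix.toEuclideanLin M z) ≤ lambdaMax M * ‖z‖ ^ 2 := by
  have h := inner_toEuclideanLin_nonneg (posSemidef_lambdaMax_sub hM) z
  simp only [map_sub, map_smul, LinearMap.sub_apply, LinearMap.smul_apply, toEuclideanLin_one,
    inner_sub_right, real_inner_smul_right, real_inner_self_eq_norm_sq] at h
  linarith

/-- With M = CᵀC, the form bound says ‖Cv‖² ≤ λ_max‖v‖². Cauchy–Schwarz on ‖Mz‖² = ⟪C(Mz), Cz⟫ then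
leaves one factor ‖Mz‖ to cancel. -/
theorem norm_toEuclideanLin_le {M : Matrix m m ℝ} (hM : M.PosSemidef)
    (z : EuclideanSpace ℝ m) : ‖Matrix.toEuclideanLin M z‖ ≤ lambdaMax M * ‖z‖ := by
  have key := fun z => inner_le_lambdaMax_mul_norm_sq hM.1 z
  have hl := lambdaMax_nonneg hM
  obtain ⟨C, hC⟩ := exists_eq_transpose_mul_self hM
  set c := Matrix.toEuclideanLin C
  set w := Matrix.toEuclideanLin M z with hw
  have hnorm : ∀ v, ‖c v‖ ≤ √(lambdaMax M) * ‖v‖ := fun v => by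
    refine le_of_sq_le_sq ?_ (by positivity)
    rw [mul_pow, Real.sq_sqrt hl, ← real_inner_self_eq_norm_sq, inner_toEuclideanLin,
      ← toEuclideanLin_mul, ← hC]
    exact key v
  have h1 : ‖w‖ ^ 2 = inner ℝ (c w) (c z) := by
    rw [inner_toEuclideanLin, ← toEuclideanLin_mul, ← hC, real_inner_self_eq_norm_sq]
  have h2 : ‖w‖ ^ 2 ≤ lambdaMax M * ‖z‖ * ‖w‖ := by
    calc ‖w‖ ^ 2 ≤ ‖c w‖ * ‖c z‖ := h1 ▸ real_inner_le_norm _ _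
      _ ≤ (√(lambdaMax M) * ‖w‖) * (√(lambdaMax M) * ‖z‖) := by gcongr <;> exact hnorm _
      _ = (√(lambdaMax M) * √(lambdaMax M)) * ‖z‖ * ‖w‖ := by ring
      _ = _ := by rw [Real.mul_self_sqrt hl]
  rcases (norm_nonneg w).eq_or_lt with h | h
  · rw [← h]; positivity
  · rw [sq] at h2
    exact le_of_mul_le_mul_right h2 h

/-- The lower bound of the Kronecker product `G ⊗ M` by `lambdaMin G` times `1 ⊗ M`. -/
theorem lambdaMin_mul_sum_inner_le {M : Matrix k k ℝ} (hM : M.PosSemidef) {G : Matrix m m ℝ}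
    (hG : G.IsHermitian) (z : m → EuclideanSpace ℝ k) :
    lambdaMin G * ∑ i, inner ℝ (z i) (Matrix.toEuclideanLin M (z i)) ≤
      ∑ i, ∑ j, G i j * inner ℝ (z i) (Matrix.toEuclideanLin M (z j)) := by
  -- In the vectors C zᵢ the weight M = CᵀC disappears.
  obtain ⟨C, rfl⟩ := exists_eq_transpose_mul_self hM
  simp only [toEuclideanLin_mul, ← inner_toEuclideanLin, real_inner_self_eq_norm_sq]
  exact lambdaMin_mul_sum_le hG _

end SpectralBounds

/-! ### The matrix ℒ + G and the existence of Θ -/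

/-- A symmetric matrix with nonpositive off-diagonal entries that maps some positive vector to a
positive vector is positive definite. -/
theorem posDef_of_offDiag_nonpos {m : Type*} [Fintype m] {S : Matrix m m ℝ} (hS : S.IsHermitian)
    (hoff : ∀ i j, i ≠ j → S i j ≤ 0) {x : m → ℝ} (hx : ∀ i, 0 < x i)
    (hSx : ∀ i, 0 < (S *ᵥ x) i) : S.PosDef := by
  refine Matrix.PosDef.of_dotProduct_mulVec_pos hS fun v hv => ?_
  have hsymm : ∀ i j, S j i = S i j := fun i j => by simpa using hS.apply i j
  -- Scaling by x moves the hypothesis on Sx onto the terms wᵢ².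
  obtain ⟨w, rfl⟩ : ∃ w : m → ℝ, v = fun i => x i * w i :=
    ⟨fun i => v i / x i, funext fun i => by field_simp [(hx i).ne']⟩
  obtain ⟨i₀, hi₀⟩ : ∃ i, w i ≠ 0 := by
    by_contra! h
    exact hv (funext fun i => by simp [h i])
  have hquad : star (fun i => x i * w i) ⬝ᵥ S *ᵥ (fun i => x i * w i) =
      ∑ i, ∑ j, S i j * x i * x j * (w i * w j) := by
    simp only [dotProduct, Matrix.mulVec, star_trivial, Finset.mul_sum]
    exact Finset.sum_congr rfl fun i _ => Finset.sum_congr rfl fun j _ => by ring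
  have hdiag : ∑ i, ∑ j, S i j * x i * x j * (w i ^ 2) = ∑ i, w i ^ 2 * x i * (S *ᵥ x) i := by
    simp only [dotProduct, Matrix.mulVec, Finset.mul_sum]
    exact Finset.sum_congr rfl fun i _ => Finset.sum_congr rfl fun j _ => by ring
  have hdiag' : ∑ i, ∑ j, S i j * x i * x j * (w j ^ 2) = ∑ i, w i ^ 2 * x i * (S *ᵥ x) i := by
    rw [← hdiag, Finset.sum_comm]
    exact Finset.sum_congr rfl fun i _ => Finset.sum_congr rfl fun j _ => by
      rw [hsymm i j]; ring
  have hpos : 0 < ∑ i, w i ^ 2 * x i * (S *ᵥ x) i := by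
    refine Finset.sum_pos' (fun i _ => ?_) ⟨i₀, Finset.mem_univ _, ?_⟩
    · have := hx i; have := hSx i; positivity
    · have := hx i₀; have := hSx i₀; positivity
  -- Off the diagonal the coefficient is nonpositive, which reverses 2wᵢwⱼ ≤ wᵢ² + wⱼ²; on the
  -- diagonal both sides agree.
  have hle : ∑ i, ∑ j, S i j * x i * x j * (w i ^ 2) + ∑ i, ∑ j, S i j * x i * x j * (w j ^ 2) ≤
      2 * ∑ i, ∑ j, S i j * x i * x j * (w i * w j) := by
    simp only [Finset.mul_sum, ← Finset.sum_add_distrib]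
    refine Finset.sum_le_sum fun i _ => Finset.sum_le_sum fun j _ => ?_
    rcases eq_or_ne i j with rfl | hij
    · exact le_of_eq (by ring)
    · have h1 : S i j * (x i * x j) ≤ 0 :=
        mul_nonpos_of_nonpos_of_nonneg (hoff i j hij) (mul_pos (hx i) (hx j)).le
      nlinarith [sq_nonneg (w i - w j)]
  rw [hquad]
  linarith

theorem inv_diagonal {m : Type*} [Fintype m] [DecidableEq m] {v : m → ℝ} (hv : ∀ i, v i ≠ 0) :
    (Matrix.diagonal v)⁻¹ = Matrix.diagonal fun i => (v i)⁻¹ := by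
  refine Matrix.inv_eq_right_inv ?_
  rw [Matrix.diagonal_mul_diagonal, ← Matrix.diagonal_one]
  exact congrArg _ (funext fun i => mul_inv_cancel₀ (hv i))

namespace Network

variable {N : ℕ} (net : Network N)

theorem adj_nonneg (i j : Fin N) : 0 ≤ net.adj i j := by
  simp only [adj, Matrix.of_apply]; split_ifs <;> norm_num

theorem adj_eq_one {i j : Fin N} (h : net.graph.Adj j i) : net.adj i j = 1 := by
  simp [adj, h]

theorem pin_nonneg (i : Fin N) : 0 ≤ net.pin i := by
  simp only [pin]; split_ifs <;> norm_num

theorem pin_eq_one {i : Fin N} (h : i ∈ net.pinned) : net.pin i = 1 := by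
  simp [pin, h]

theorem coupling_offDiag {i j : Fin N} (h : i ≠ j) : net.coupling i j = -net.adj i j := by
  simp [coupling, laplacian, h]

theorem sum_coupling_smul {E : Type*} [AddCommGroup E] [Module ℝ E] (v : Fin N → E) (i : Fin N) :
    ∑ j, net.coupling i j • v j = ∑ j, net.adj i j • (v i - v j) + net.pin i • v i := by
  simp only [coupling, laplacian, Matrix.add_apply, Matrix.sub_apply, Matrix.diagonal_apply,
    add_smul, sub_smul, ite_smul, zero_smul, Finset.sum_add_distrib, Finset.sum_sub_distrib,
    Finset.sum_ite_eq, Finset.mem_univ, if_true, smul_sub, Finset.sum_smul]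

theorem coupling_mulVec (v : Fin N → ℝ) (i : Fin N) :
    (net.coupling *ᵥ v) i = ∑ j, net.adj i j * (v i - v j) + net.pin i * v i := by
  simpa [Matrix.mulVec, dotProduct] using net.sum_coupling_smul v i

theorem sum_neighbors {E : Type*} [AddCommGroup E] [Module ℝ E] (f : Fin N → E) (i : Fin N) :
    ∑ j ∈ net.neighbors i, f j = ∑ j, net.adj i j • f j := by
  simp [neighbors, adj, Finset.sum_filter, ite_smul]

variable {net}

/-- Minimum principle for `ℒ + G`. -/
theorem HasPinnedSpanningTree.nonneg_of_mulVec_nonneg (h : net.HasPinnedSpanningTree)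
    {v : Fin N → ℝ} (hv : ∀ i, 0 ≤ (net.coupling *ᵥ v) i) (i : Fin N) : 0 ≤ v i := by
  obtain ⟨r, hr, T, hT⟩ := h
  have : Nonempty (Fin N) := ⟨r⟩
  obtain ⟨i₀, hi₀⟩ := Finite.exists_min v
  refine le_trans ?_ (hi₀ i)
  by_contra! hneg
  have hterm : ∀ c, v c = v i₀ → ∀ j, net.adj c j * (v c - v j) ≤ 0 := fun c hc j =>
    mul_nonpos_of_nonneg_of_nonpos (net.adj_nonneg c j) (by linarith [hi₀ j])
  have hpin : ∀ c, v c = v i₀ → net.pin c * v c ≤ 0 := fun c hc =>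
    mul_nonpos_of_nonneg_of_nonpos (net.pin_nonneg c) (by linarith)
  -- At a node attaining the negative minimum every term of the row is nonpositive, yet the row sum
  -- is nonnegative. So its parent attains the minimum too, and so on back to the root, where the
  -- pinning term is strictly negative.
  have hroot : v r = v i₀ := by
    refine Relation.ReflTransGen.head_induction_on (motive := fun a _ => v a = v i₀)
      (hT.reach i₀) rfl ?_
    intro a c hac _ hc
    have h1 := hv c
    rw [coupling_mulVec] at h1
    have h2 := Finset.sum_le_sum_of_subset_of_nonneg (f := fun j => -(net.adj c j * (v c - v j)))
      (Finset.subset_univ {a}) (fun j _ _ => neg_nonneg.2 (hterm c hc j))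
    rw [Finset.sum_singleton, Finset.sum_neg_distrib, net.adj_eq_one (hT.sub hac)] at h2
    have h3 := hpin c hc
    have h4 := hi₀ a
    linarith
  have h1 := hv r
  rw [coupling_mulVec, net.pin_eq_one hr] at h1
  have h2 := Finset.sum_nonpos fun j (_ : j ∈ Finset.univ) => hterm r hroot j
  linarith

/-- The minimum principle applies to a kernel vector and to its negative. -/
theorem HasPinnedSpanningTree.isUnit_coupling (h : net.HasPinnedSpanningTree) :
    IsUnit net.coupling := by
  rw [← Matrix.mulVec_injective_iff_isUnit]
  intro v w hvw
  have hd : net.coupling *ᵥ (v - w) = 0 := by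
    rw [Matrix.mulVec_sub]; exact sub_eq_zero.2 hvw
  have hd' : net.coupling *ᵥ (w - v) = 0 := by
    rw [Matrix.mulVec_sub]; exact sub_eq_zero.2 hvw.symm
  ext i
  have h1 := h.nonneg_of_mulVec_nonneg (v := v - w) (fun i => by simp [hd]) i
  have h2 := h.nonneg_of_mulVec_nonneg (v := w - v) (fun i => by simp [hd']) i
  simp only [Pi.sub_apply] at h1 h2
  linarith

theorem matH_apply {ϑ : Fin N → ℝ} (hϑ : ∀ i, 0 < ϑ i) (i j : Fin N) :
    net.matH ϑ i j = (ϑ i)⁻¹ * net.coupling i j + (ϑ j)⁻¹ * net.coupling j i := by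
  simp only [matH, inv_diagonal fun i => (hϑ i).ne', Matrix.add_apply, Matrix.diagonal_mul,
    Matrix.mul_diagonal, Matrix.transpose_apply]
  ring

/-- Let M = ℒ+G, Mx = 1, M'y = 1 and ϑᵢ = xᵢ/yᵢ. Then Θ⁻¹x = y, so Hx = Θ⁻¹Mx + M'y = Θ⁻¹1 + 1 is
positive, and `posDef_of_offDiag_nonpos` applies. -/
theorem HasPinnedSpanningTree.exists_matH_posDef (h : net.HasPinnedSpanningTree) :
    ∃ ϑ : Fin N → ℝ, (∀ i, 0 < ϑ i) ∧ (net.matH ϑ).PosDef := by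
  have hu := (Matrix.isUnit_iff_isUnit_det _).1 h.isUnit_coupling
  set M := net.coupling with hM
  have hMx : M *ᵥ (M⁻¹ *ᵥ 1) = 1 := by
    rw [Matrix.mulVec_mulVec, Matrix.mul_nonsing_inv _ hu, Matrix.one_mulVec]
  have hMy : Mᵀ *ᵥ ((M⁻¹)ᵀ *ᵥ 1) = 1 := by
    rw [Matrix.mulVec_mulVec, ← Matrix.transpose_mul, Matrix.nonsing_inv_mul _ hu,
      Matrix.transpose_one, Matrix.one_mulVec]
  -- The columns of M⁻¹ are mapped to standard basis vectors.
  have hinv : ∀ i j, 0 ≤ M⁻¹ i j := fun i j => by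
    refine h.nonneg_of_mulVec_nonneg (v := fun i => M⁻¹ i j) (fun l => ?_) i
    have : (net.coupling *ᵥ fun i => M⁻¹ i j) l = (M * M⁻¹) l j := rfl
    rw [this, Matrix.mul_nonsing_inv _ hu, Matrix.one_apply]
    split_ifs <;> norm_num
  set x := M⁻¹ *ᵥ (1 : Fin N → ℝ) with hx
  set y := (M⁻¹)ᵀ *ᵥ (1 : Fin N → ℝ) with hy
  -- If zᵢ = 0, row i of Kz has only nonpositive off-diagonal contributions and cannot equal 1.
  have hpos : ∀ (K : Matrix (Fin N) (Fin N) ℝ) (z : Fin N → ℝ), (∀ i j, i ≠ j → K i j ≤ 0) →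
      (∀ i, 0 ≤ z i) → K *ᵥ z = 1 → ∀ i, 0 < z i := by
    intro K z hK hz hKz i
    refine (hz i).lt_of_ne fun hi => ?_
    have h1 : (K *ᵥ z) i ≤ 0 := by
      rw [Matrix.mulVec, dotProduct]
      refine Finset.sum_nonpos fun j _ => ?_
      rcases eq_or_ne i j with rfl | hij
      · simp [← hi]
      · exact mul_nonpos_of_nonpos_of_nonneg (hK i j hij) (hz j)
    rw [hKz] at h1
    simp only [Pi.one_apply] at h1
    linarith
  have hoff : ∀ i j, i ≠ j → M i j ≤ 0 := fun i j hij => by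
    rw [hM, net.coupling_offDiag hij]
    linarith [net.adj_nonneg i j]
  have hx0 : ∀ i, 0 < x i := hpos M x hoff
    (fun i => by
      rw [hx, Matrix.mulVec, dotProduct]
      exact Finset.sum_nonneg fun j _ => by simpa using hinv i j) hMx
  have hy0 : ∀ i, 0 < y i := hpos Mᵀ y (fun i j hij => hoff j i hij.symm)
    (fun i => by
      rw [hy, Matrix.mulVec, dotProduct]
      exact Finset.sum_nonneg fun j _ => by simpa using hinv j i) hMy
  have hϑ : ∀ i, 0 < x i / y i := fun i => div_pos (hx0 i) (hy0 i)
  have happ := matH_apply (net := net) hϑ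
  refine ⟨fun i => x i / y i, hϑ, posDef_of_offDiag_nonpos ?_ ?_ hx0 ?_⟩
  · refine Matrix.IsHermitian.ext fun i j => ?_
    rw [star_trivial, happ, happ, add_comm]
  · intro i j hij
    rw [happ]
    exact add_nonpos
      (mul_nonpos_of_nonneg_of_nonpos (inv_nonneg.2 (hϑ i).le) (hoff i j hij))
      (mul_nonpos_of_nonneg_of_nonpos (inv_nonneg.2 (hϑ j).le) (hoff j i hij.symm))
  · intro i
    have h1 : (net.matH (fun i => x i / y i) *ᵥ x) i =
        (x i / y i)⁻¹ * (M *ᵥ x) i + (Mᵀ *ᵥ y) i := by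
      simp only [Matrix.mulVec, dotProduct, happ, Finset.mul_sum, ← Finset.sum_add_distrib,
        Matrix.transpose_apply]
      refine Finset.sum_congr rfl fun j _ => ?_
      have := (hx0 j).ne'
      have := (hy0 j).ne'
      rw [← hM]
      field_simp
    rw [h1, hMx, hMy]
    have := hϑ i
    simp only [Pi.one_apply]
    positivity

theorem matF_posDef (h : net.HasPinnedSpanningTree) : net.matF.PosDef := by
  rw [matF, ← Matrix.conjTranspose_eq_transpose_of_trivial]
  exact Matrix.PosDef.conjTranspose_mul_self _
    (Matrix.mulVec_injective_iff_isUnit.2 h.isUnit_coupling)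

/-- This is the factored shape that `sum_norm_sq_sum_smul` asks for. -/
theorem matP_eq (ϑ : Fin N → ℝ) : net.matP ϑ =
    ((Matrix.diagonal ϑ)⁻¹ * net.coupling) * ((Matrix.diagonal ϑ)⁻¹ * net.coupling)ᵀ := by
  rw [matP, Matrix.transpose_mul, Matrix.transpose_nonsing_inv, Matrix.diagonal_transpose]
  simp only [Matrix.mul_assoc]

theorem matP_posSemidef (ϑ : Fin N → ℝ) : (net.matP ϑ).PosSemidef := by
  rw [matP_eq, ← Matrix.conjTranspose_eq_transpose_of_trivial]
  exact Matrix.posSemidef_self_mul_conjTranspose _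

variable (net) in
theorem combState_eq {n : ℕ} (x₀ : ℝ → EuclideanSpace ℝ (Fin n))
    (x : Fin N → ℝ → EuclideanSpace ℝ (Fin n)) (i : Fin N) (t : ℝ) :
    net.combState x₀ x i t = ∑ j, net.coupling i j • (x₀ t - x j t) := by
  rw [sum_coupling_smul, combState, sum_neighbors]
  simp

/-- The right side is the quadratic form of F at the tracking errors. This converts bounds on z into
bounds on x₀ − xᵢ. -/
theorem lambdaMin_matF_mul_le {n : ℕ} (x₀ : ℝ → EuclideanSpace ℝ (Fin n))
    (x : Fin N → ℝ → EuclideanSpace ℝ (Fin n)) (t : ℝ) :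
    lambdaMin net.matF * ∑ i, ‖x₀ t - x i t‖ ^ 2 ≤ ∑ i, ‖net.combState x₀ x i t‖ ^ 2 := by
  have h := sum_norm_sq_sum_smul net.couplingᵀ fun i => x₀ t - x i t
  simp only [Matrix.transpose_transpose, Matrix.transpose_apply] at h
  simp only [combState_eq, h]
  refine lambdaMin_mul_sum_le (G := net.matF) ?_ _
  rw [matF, ← Matrix.conjTranspose_eq_transpose_of_trivial]
  exact Matrix.isHermitian_conjTranspose_mul_self _

end Network

/-! ### The Lyapunov function and its dissipation inequality -/

variable {N n p : ℕ}

theorem iInf_fin_pos [Nonempty (Fin N)] {f : Fin N → ℝ} (hf : ∀ i, 0 < f i) : 0 < ⨅ i, f i := by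
  obtain ⟨i, hi⟩ := exists_eq_ciInf_of_finite (f := f)
  exact hi ▸ hf i

theorem iInf_fin_le (f : Fin N → ℝ) (i : Fin N) : ⨅ j, f j ≤ f i :=
  ciInf_le (Set.finite_range f).bddBelow i

theorem matS_posSemidef (B : Matrix (Fin n) (Fin p) ℝ) {R : Matrix (Fin p) (Fin p) ℝ}
    (hR : R.PosDef) {Y : Matrix (Fin n) (Fin n) ℝ} (hY : Y.PosDef) :
    (matS B R Y).PosSemidef := by
  have hYt : Yᵀ = Y := by simpa using hY.1.eq
  have h := hR.inv.posSemidef.conjTranspose_mul_mul_same (Bᵀ * Y)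
  rw [Matrix.conjTranspose_eq_transpose_of_trivial, Matrix.transpose_mul, hYt,
    Matrix.transpose_transpose] at h
  simpa only [matS, Matrix.mul_assoc] using h

theorem Network.alpha_pos {net : Network N} [Nonempty (Fin N)] {ϑ : Fin N → ℝ}
    (hH : (net.matH ϑ).PosDef) : 0 < net.alpha ϑ := by
  have := lambdaMin_pos hH
  rw [Network.alpha]
  positivity

section Quadratic

variable {net : Network N} {A : Matrix (Fin n) (Fin n) ℝ} {B : Matrix (Fin n) (Fin p) ℝ}
  {R : Matrix (Fin p) (Fin p) ℝ} {Q Y : Matrix (Fin n) (Fin n) ℝ} {ϑ : Fin N → ℝ}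

/-- The term in Q is weakened to one in Y by v'Qv ≥ λ_min(Q)‖v‖² ≥ α₁ v'Yv. -/
theorem Riccati.inner_le [Nonempty (Fin n)] (h : Riccati A B R Q Y ϑ) (hQ : Q.PosDef)
    (hY : Y.PosDef) (v : EuclideanSpace ℝ (Fin n)) :
    2 * inner ℝ (Matrix.toEuclideanLin Y v) (Matrix.toEuclideanLin A v) ≤
      2 * (⨅ i, ϑ i) * inner ℝ v (Matrix.toEuclideanLin (matS B R Y) v) -
        alpha₁ Q Y * inner ℝ v (Matrix.toEuclideanLin Y v) := by
  have hYt : Yᵀ = Y := by simpa using hY.1.eq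
  have h1 := inner_toEuclideanLin_nonneg h v
  simp only [map_neg, map_add, map_sub, map_smul, LinearMap.neg_apply, LinearMap.add_apply,
    LinearMap.sub_apply, LinearMap.smul_apply, inner_neg_right, inner_add_right, inner_sub_right,
    real_inner_smul_right, toEuclideanLin_mul] at h1
  have h2 : inner ℝ v (Matrix.toEuclideanLin Y (Matrix.toEuclideanLin A v)) =
      inner ℝ (Matrix.toEuclideanLin Y v) (Matrix.toEuclideanLin A v) := by
    rw [inner_toEuclideanLin, hYt]
  have h3 : inner ℝ v (Matrix.toEuclideanLin Aᵀ (Matrix.toEuclideanLin Y v)) =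
      inner ℝ (Matrix.toEuclideanLin Y v) (Matrix.toEuclideanLin A v) := by
    rw [← inner_toEuclideanLin, real_inner_comm]
  rw [h2, h3] at h1
  have hmin := lambdaMin_pos hQ
  have hmax := (lambdaMin_pos hY).trans_le (lambdaMin_le_lambdaMax hY.1)
  have h4 : alpha₁ Q Y * inner ℝ v (Matrix.toEuclideanLin Y v) ≤
      inner ℝ v (Matrix.toEuclideanLin Q v) := by
    refine le_trans ?_ (lambdaMin_mul_norm_sq_le hQ.1 v)
    calc alpha₁ Q Y * inner ℝ v (Matrix.toEuclideanLin Y v)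
        ≤ alpha₁ Q Y * (lambdaMax Y * ‖v‖ ^ 2) :=
          mul_le_mul_of_nonneg_left (inner_le_lambdaMax_mul_norm_sq hY.1 v)
            (div_pos hmin hmax).le
      _ = lambdaMin Q * ‖v‖ ^ 2 := by rw [alpha₁]; field_simp
  linarith

/-- The Lyapunov function `∑ᵢ ϑᵢ⁻¹ zᵢ' Y zᵢ`. -/
def lyapunov (Y : Matrix (Fin n) (Fin n) ℝ) (ϑ : Fin N → ℝ)
    (z : Fin N → EuclideanSpace ℝ (Fin n)) : ℝ :=
  ∑ i, (ϑ i)⁻¹ * inner ℝ (z i) (Matrix.toEuclideanLin Y (z i))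

theorem mul_sum_norm_sq_le_lyapunov [Nonempty (Fin n)] (hY : Y.PosDef) (hϑ : ∀ i, 0 < ϑ i)
    (z : Fin N → EuclideanSpace ℝ (Fin n)) :
    (⨅ i, (ϑ i)⁻¹) * lambdaMin Y * ∑ i, ‖z i‖ ^ 2 ≤ lyapunov Y ϑ z := by
  rw [lyapunov, Finset.mul_sum]
  refine Finset.sum_le_sum fun i _ => ?_
  have := lambdaMin_pos hY
  calc _ = (⨅ i, (ϑ i)⁻¹) * (lambdaMin Y * ‖z i‖ ^ 2) := by ring
    _ ≤ (ϑ i)⁻¹ * (lambdaMin Y * ‖z i‖ ^ 2) := by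
      gcongr
      exact iInf_fin_le (fun i => (ϑ i)⁻¹) i
    _ ≤ _ := by
      have := hϑ i
      gcongr
      exact lambdaMin_mul_norm_sq_le hY.1 _

/-- As S is symmetric, the two halves of H = Θ⁻¹(ℒ+G) + (ℒ+G)'Θ⁻¹ contribute equally, which accounts
for the factor 1/2 in α. -/
theorem sum_lambdaMin_matH_le {S : Matrix (Fin n) (Fin n) ℝ} (hS : S.PosSemidef)
    (hϑ : ∀ i, 0 < ϑ i) (hH : (net.matH ϑ).PosDef) (z : Fin N → EuclideanSpace ℝ (Fin n)) :
    net.alpha ϑ * ∑ i, inner ℝ (z i) (Matrix.toEuclideanLin S (z i)) ≤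
      ∑ i, ∑ j, (ϑ i)⁻¹ * net.coupling i j * inner ℝ (z i) (Matrix.toEuclideanLin S (z j)) := by
  have hSt : Sᵀ = S := by simpa using hS.1.eq
  have h := lambdaMin_mul_sum_inner_le hS hH.1 z
  simp only [Network.matH_apply hϑ, add_mul, Finset.sum_add_distrib] at h
  have h2 : ∑ i, ∑ j, (ϑ j)⁻¹ * net.coupling j i * inner ℝ (z i) (Matrix.toEuclideanLin S (z j)) =
      ∑ i, ∑ j, (ϑ i)⁻¹ * net.coupling i j * inner ℝ (z i) (Matrix.toEuclideanLin S (z j)) := by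
    rw [Finset.sum_comm]
    refine Finset.sum_congr rfl fun i _ => Finset.sum_congr rfl fun j _ => ?_
    rw [← hSt, ← inner_toEuclideanLin, real_inner_comm, hSt]
  rw [h2] at h
  rw [Network.alpha]
  linarith

/-- The left side is the quadratic form of P at the vectors S zᵢ. The factors of α₂ come from
λ_max(P), from ‖S zᵢ‖ ≤ λ_max(S)‖zᵢ‖, and from bounding ∑‖zᵢ‖² by V. -/
theorem sum_norm_sq_weighted_le [Nonempty (Fin n)] [Nonempty (Fin N)]
    (hR : R.PosDef) (hY : Y.PosDef) (hϑ : ∀ i, 0 < ϑ i)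
    (z : Fin N → EuclideanSpace ℝ (Fin n)) :
    ∑ j, ‖∑ i, ((ϑ i)⁻¹ * net.coupling i j) • Matrix.toEuclideanLin (matS B R Y) (z i)‖ ^ 2 ≤
      alpha₂ net B R Y ϑ * lyapunov Y ϑ z := by
  have hP := Network.matP_posSemidef (net := net) ϑ
  have hP0 := lambdaMax_nonneg hP
  have hS := matS_posSemidef B hR hY
  have h1 := sum_norm_sq_sum_smul ((Matrix.diagonal ϑ)⁻¹ * net.coupling)
    fun i => Matrix.toEuclideanLin (matS B R Y) (z i)
  rw [← Network.matP_eq] at h1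
  simp only [inv_diagonal fun i => (hϑ i).ne', Matrix.diagonal_mul] at h1
  rw [h1]
  have hc : 0 < (⨅ i, (ϑ i)⁻¹) * lambdaMin Y :=
    mul_pos (iInf_fin_pos fun i => inv_pos.2 (hϑ i)) (lambdaMin_pos hY)
  calc _ ≤ lambdaMax (net.matP ϑ) * ∑ i, ‖Matrix.toEuclideanLin (matS B R Y) (z i)‖ ^ 2 :=
        sum_le_lambdaMax_mul hP.1 _
    _ ≤ lambdaMax (net.matP ϑ) * ∑ i, (lambdaMax (matS B R Y) * ‖z i‖) ^ 2 := by
        gcongr with i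
        exact norm_toEuclideanLin_le hS _
    _ = alpha₂ net B R Y ϑ * ((⨅ i, (ϑ i)⁻¹) * lambdaMin Y * ∑ i, ‖z i‖ ^ 2) := by
        simp only [mul_pow, ← Finset.mul_sum]
        rw [alpha₂, ← mul_assoc, ← mul_assoc, div_mul_cancel₀ _ hc.ne']
    _ ≤ _ := by
        refine mul_le_mul_of_nonneg_left (mul_sum_norm_sq_le_lyapunov hY hϑ z) ?_
        rw [alpha₂]
        positivity

theorem inner_input_eq (hY : Y.PosDef) (u v : EuclideanSpace ℝ (Fin n)) :
    inner ℝ (Matrix.toEuclideanLin Y u) (Matrix.toEuclideanLin B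
      (-Matrix.toEuclideanLin (gain net B R Y ϑ) v)) =
      1 / net.alpha ϑ * inner ℝ u (Matrix.toEuclideanLin (matS B R Y) v) := by
  have hYt : Yᵀ = Y := by simpa using hY.1.eq
  simp only [gain, matS, map_smul, LinearMap.smul_apply, toEuclideanLin_mul, map_neg, neg_smul,
    LinearMap.neg_apply, neg_neg, real_inner_smul_right, inner_toEuclideanLin Y, hYt]

/-- The derivative of the Lyapunov function along the closed loop with measurement errors `s`. -/
theorem lyapunov_deriv_le [Nonempty (Fin n)] [Nonempty (Fin N)] (hR : R.PosDef) (hQ : Q.PosDef)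
    (hϑ : ∀ i, 0 < ϑ i) (hH : (net.matH ϑ).PosDef) (hY : Y.PosDef) (hric : Riccati A B R Q Y ϑ)
    {ω : ℝ} (hω : 0 < ω) (z s : Fin N → EuclideanSpace ℝ (Fin n)) :
    2 * ∑ i, (ϑ i)⁻¹ * inner ℝ (Matrix.toEuclideanLin Y (z i)) (Matrix.toEuclideanLin A (z i) -
      ∑ j, net.coupling i j • Matrix.toEuclideanLin B
        (-Matrix.toEuclideanLin (gain net B R Y ϑ) (z j + s j))) ≤
      -(alpha₁ Q Y - ω / net.alpha ϑ * alpha₂ net B R Y ϑ) * lyapunov Y ϑ z +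
        1 / (net.alpha ϑ * ω) * ∑ j, ‖s j‖ ^ 2 := by
  have hα := Network.alpha_pos hH
  set α := net.alpha ϑ with hαdef
  set S := matS B R Y with hSdef
  have hS : S.PosSemidef := matS_posSemidef B hR hY
  have hSt : Sᵀ = S := by simpa using hS.1.eq
  have hexp : ∑ i, (ϑ i)⁻¹ * inner ℝ (Matrix.toEuclideanLin Y (z i))
      (Matrix.toEuclideanLin A (z i) - ∑ j, net.coupling i j • Matrix.toEuclideanLin B
        (-Matrix.toEuclideanLin (gain net B R Y ϑ) (z j + s j))) =
      ∑ i, (ϑ i)⁻¹ * inner ℝ (Matrix.toEuclideanLin Y (z i)) (Matrix.toEuclideanLin A (z i)) -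
      1 / α * ∑ i, ∑ j, (ϑ i)⁻¹ * net.coupling i j *
        inner ℝ (z i) (Matrix.toEuclideanLin S (z j)) -
      1 / α * ∑ j, inner ℝ
        (∑ i, ((ϑ i)⁻¹ * net.coupling i j) • Matrix.toEuclideanLin S (z i)) (s j) := by
    simp only [sum_inner, real_inner_smul_left]
    rw [Finset.sum_comm (f := fun j i => (ϑ i)⁻¹ * net.coupling i j *
      inner ℝ (Matrix.toEuclideanLin S (z i)) (s j))]
    simp only [Finset.mul_sum, ← Finset.sum_sub_distrib, inner_sub_right, inner_sum,
      real_inner_smul_right, inner_input_eq hY, mul_sub]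
    refine Finset.sum_congr rfl fun i _ => ?_
    rw [sub_sub, ← Finset.sum_add_distrib]
    congr 1
    refine Finset.sum_congr rfl fun j _ => ?_
    rw [inner_toEuclideanLin, hSt, map_add, inner_add_right]
    ring
  have h1 : 2 * ∑ i, (ϑ i)⁻¹ *
      inner ℝ (Matrix.toEuclideanLin Y (z i)) (Matrix.toEuclideanLin A (z i)) ≤
      2 * ∑ i, inner ℝ (z i) (Matrix.toEuclideanLin S (z i)) - alpha₁ Q Y * lyapunov Y ϑ z := by
    rw [lyapunov, Finset.mul_sum, Finset.mul_sum, Finset.mul_sum, ← Finset.sum_sub_distrib]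
    refine Finset.sum_le_sum fun i _ => ?_
    have hi := inv_pos.2 (hϑ i)
    have ha := mul_le_mul_of_nonneg_left (hric.inner_le hQ hY (z i)) hi.le
    -- The Riccati term in S enters with weight 2ϑᵢ⁻¹ϑ_min ≤ 2, uniformly in i.
    have hb : (ϑ i)⁻¹ * ⨅ i, ϑ i ≤ 1 := by
      calc (ϑ i)⁻¹ * ⨅ i, ϑ i ≤ (ϑ i)⁻¹ * ϑ i :=
            mul_le_mul_of_nonneg_left (iInf_fin_le ϑ i) hi.le
        _ = 1 := inv_mul_cancel₀ (hϑ i).ne'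
    have hc := mul_le_mul_of_nonneg_right hb (inner_toEuclideanLin_nonneg hS (z i))
    linarith
  have h2 : 2 * ∑ i, inner ℝ (z i) (Matrix.toEuclideanLin S (z i)) ≤
      2 * (1 / α * ∑ i, ∑ j, (ϑ i)⁻¹ * net.coupling i j *
        inner ℝ (z i) (Matrix.toEuclideanLin S (z j))) := by
    have h := mul_le_mul_of_nonneg_left (sum_lambdaMin_matH_le hS hϑ hH z) (one_div_pos.2 hα).le
    rw [← mul_assoc, one_div_mul_cancel hα.ne', one_mul] at h
    linarith
  have h3 : -(2 * (1 / α * ∑ j, inner ℝ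
      (∑ i, ((ϑ i)⁻¹ * net.coupling i j) • Matrix.toEuclideanLin S (z i)) (s j))) ≤
      ω / α * (alpha₂ net B R Y ϑ * lyapunov Y ϑ z) + 1 / (α * ω) * ∑ j, ‖s j‖ ^ 2 := by
    have h := mul_le_mul_of_nonneg_left
      (sum_norm_sq_weighted_le (net := net) (B := B) hR hY hϑ z) (div_pos hω hα).le
    refine le_trans ?_ (add_le_add_left h _)
    simp only [Finset.mul_sum, ← Finset.sum_add_distrib, ← Finset.sum_neg_distrib]
    refine Finset.sum_le_sum fun j _ => ?_
    generalize (∑ i, ((ϑ i)⁻¹ * net.coupling i j) • Matrix.toEuclideanLin S (z i)) = q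
    -- Young's inequality, as ‖ωq + s‖² ≥ 0 divided by αω.
    have hq := real_inner_self_nonneg (x := ω • q + s j)
    rw [inner_add_add_self, real_inner_smul_left, real_inner_smul_right, real_inner_smul_left,
      real_inner_smul_right, real_inner_comm q (s j), real_inner_self_eq_norm_sq,
      real_inner_self_eq_norm_sq] at hq
    have hq' := mul_nonneg (one_div_pos.2 (mul_pos hα hω)).le hq
    have : 1 / (α * ω) * (ω * (ω * ‖q‖ ^ 2) + ω * inner ℝ q (s j) + ω * inner ℝ q (s j) +
        ‖s j‖ ^ 2) = ω / α * ‖q‖ ^ 2 + 2 * (1 / α * inner ℝ q (s j)) +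
        1 / (α * ω) * ‖s j‖ ^ 2 := by
      field_simp
      ring
    linarith
  rw [hexp]
  linarith

/-- The factor αω of the trigger level cancels 1/(αω). Its μᵢ-term is charged to the decay of the
i-th summand of V, which lowers that rate to ρᵢ ≥ ρ_min. -/
theorem lyapunov_deriv_le_of_trigger [Nonempty (Fin n)] [Nonempty (Fin N)] (hR : R.PosDef)
    (hQ : Q.PosDef) (hϑ : ∀ i, 0 < ϑ i) (hH : (net.matH ϑ).PosDef) (hY : Y.PosDef)
    (hric : Riccati A B R Q Y ϑ) {ω γ : ℝ} {μ ν σ : Fin N → ℝ} (hω : 0 < ω) {t : ℝ}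
    (z s : Fin N → EuclideanSpace ℝ (Fin n))
    (hs : ∀ i, ‖s i‖ ^ 2 ≤ triggerLevel net Y ϑ ω μ ν σ γ i t (z i)) :
    2 * ∑ i, (ϑ i)⁻¹ * inner ℝ (Matrix.toEuclideanLin Y (z i)) (Matrix.toEuclideanLin A (z i) -
      ∑ j, net.coupling i j • Matrix.toEuclideanLin B
        (-Matrix.toEuclideanLin (gain net B R Y ϑ) (z j + s j))) ≤
      -(⨅ i, rho net B R Q Y ϑ ω μ i) * lyapunov Y ϑ z +
        (N * γ + ∑ i, ν i * Real.exp (-σ i * t)) := by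
  refine (lyapunov_deriv_le hR hQ hϑ hH hY hric hω z s).trans ?_
  have hα := Network.alpha_pos hH
  have h1 : 1 / (net.alpha ϑ * ω) * ∑ j, ‖s j‖ ^ 2 ≤
      ∑ i, (μ i * (ϑ i)⁻¹ * inner ℝ (z i) (Matrix.toEuclideanLin Y (z i)) +
        ν i * Real.exp (-σ i * t) + γ) := by
    rw [one_div, inv_mul_le_iff₀ (mul_pos hα hω), Finset.mul_sum]
    exact Finset.sum_le_sum fun i _ => hs i
  simp only [Finset.sum_add_distrib, Finset.sum_const, Finset.card_univ, Fintype.card_fin,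
    nsmul_eq_mul] at h1
  have h2 : (⨅ i, rho net B R Q Y ϑ ω μ i) * lyapunov Y ϑ z ≤
      (alpha₁ Q Y - ω / net.alpha ϑ * alpha₂ net B R Y ϑ) * lyapunov Y ϑ z -
        ∑ i, μ i * (ϑ i)⁻¹ * inner ℝ (z i) (Matrix.toEuclideanLin Y (z i)) := by
    rw [lyapunov, Finset.mul_sum, Finset.mul_sum, ← Finset.sum_sub_distrib]
    refine Finset.sum_le_sum fun i _ => ?_
    have h3 : 0 ≤ (ϑ i)⁻¹ * inner ℝ (z i) (Matrix.toEuclideanLin Y (z i)) :=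
      mul_nonneg (inv_pos.2 (hϑ i)).le (inner_toEuclideanLin_nonneg hY.posSemidef _)
    have h4 := mul_le_mul_of_nonneg_right (iInf_fin_le (rho net B R Q Y ϑ ω μ) i) h3
    rw [rho] at h4
    linarith
  linarith

end Quadratic

/-! ### Comparison with a scalar linear equation -/

section Comparison

variable (N) in
/-- The solution of `W' = -ρ W + (N γ + ∑ᵢ νᵢ exp (-σᵢ t))` obtained by adding `c exp (-ρ t)` to a
particular solution. -/
def comparison (ρ γ c : ℝ) (ν σ : Fin N → ℝ) (t : ℝ) : ℝ :=
  N * γ / ρ + ∑ i, ν i / (ρ - σ i) * Real.exp (-σ i * t) + c * Real.exp (-ρ * t)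

theorem hasDerivAt_exp_mul (a t : ℝ) :
    HasDerivAt (fun t => Real.exp (a * t)) (a * Real.exp (a * t)) t := by
  simpa [mul_comm] using ((hasDerivAt_id t).const_mul a).exp

theorem hasDerivAt_comparison {ρ γ c : ℝ} {ν σ : Fin N → ℝ} (hρ : ρ ≠ 0) (hσ : ∀ i, ρ - σ i ≠ 0)
    (t : ℝ) : HasDerivAt (comparison N ρ γ c ν σ)
      (-ρ * comparison N ρ γ c ν σ t + (N * γ + ∑ i, ν i * Real.exp (-σ i * t))) t := by
  have h := ((HasDerivAt.fun_sum (u := Finset.univ) fun i _ =>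
    (hasDerivAt_exp_mul (-σ i) t).const_mul (ν i / (ρ - σ i))).const_add (N * γ / ρ)).add
    ((hasDerivAt_exp_mul (-ρ) t).const_mul c)
  refine h.congr_deriv ?_
  rw [comparison, mul_add, mul_add, Finset.mul_sum]
  have : ∑ i, ν i / (ρ - σ i) * (-σ i * Real.exp (-σ i * t)) =
      ∑ i, -ρ * (ν i / (ρ - σ i) * Real.exp (-σ i * t)) + ∑ i, ν i * Real.exp (-σ i * t) := by
    rw [← Finset.sum_add_distrib]
    refine Finset.sum_congr rfl fun i _ => ?_
    have := hσ i
    field_simp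
    ring
  have hNγ : -ρ * (N * γ / ρ) = -(N * γ) := by field_simp
  rw [this]
  linarith

/-- The integrating factor exp (ρt) removes the terms in f and W, leaving an inequality between
derivatives. Right derivatives suffice, as needed because the inputs jump at events. -/
theorem le_comparison {ρ γ c : ℝ} {ν σ : Fin N → ℝ} (hρ : ρ ≠ 0) (hσ : ∀ i, ρ - σ i ≠ 0)
    {f f' : ℝ → ℝ} {b : ℝ} (hb : 0 ≤ b) (hf : ContinuousOn f (Set.Icc 0 b))
    (hf' : ∀ t ∈ Set.Ico 0 b, HasDerivWithinAt f (f' t) (Set.Ici t) t)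
    (hle : ∀ t ∈ Set.Ico 0 b, f' t ≤ -ρ * f t + (N * γ + ∑ i, ν i * Real.exp (-σ i * t)))
    (h0 : f 0 ≤ comparison N ρ γ c ν σ 0) : f b ≤ comparison N ρ γ c ν σ b := by
  have hW := hasDerivAt_comparison (γ := γ) (c := c) (ν := ν) hρ hσ
  have h := image_le_of_deriv_right_le_deriv_boundary
    (f := fun t => Real.exp (ρ * t) * f t) (B := fun t => Real.exp (ρ * t) *
      comparison N ρ γ c ν σ t) (a := 0) (b := b)
    ((by fun_prop : Continuous fun t => Real.exp (ρ * t)).continuousOn.mul hf)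
    (fun t ht => (hasDerivAt_exp_mul ρ t).hasDerivWithinAt.mul (hf' t ht)) (by simpa using h0)
    (fun t _ => ((hasDerivAt_exp_mul ρ t).mul (hW t)).continuousAt.continuousWithinAt)
    (fun t _ => ((hasDerivAt_exp_mul ρ t).mul (hW t)).hasDerivWithinAt)
    (fun t ht => by
      have := mul_le_mul_of_nonneg_left (hle t ht) (Real.exp_pos (ρ * t)).le
      linarith)
    (Set.right_mem_Icc.2 hb)
  exact le_of_mul_le_mul_left h (Real.exp_pos _)

theorem comparison_le {ρ γ c : ℝ} {ν σ : Fin N → ℝ} (hρ : 0 < ρ) (hσ : ∀ i, 0 < σ i ∧ σ i < ρ)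
    (hν : ∀ i, 0 < ν i) (hc : 0 ≤ c) {t : ℝ} (ht : 0 ≤ t) :
    comparison N ρ γ c ν σ t ≤ comparison N ρ γ c ν σ 0 := by
  have hexp : ∀ a : ℝ, 0 < a → Real.exp (-a * t) ≤ Real.exp (-a * 0) := fun a ha =>
    Real.exp_le_exp.2 (by nlinarith)
  rw [comparison, comparison]
  exact add_le_add (add_le_add_right (Finset.sum_le_sum fun i _ =>
    mul_le_mul_of_nonneg_left (hexp _ (hσ i).1) (div_pos (hν i) (sub_pos.2 (hσ i).2)).le) _)
    (mul_le_mul_of_nonneg_left (hexp _ hρ) hc)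

theorem tendsto_comparison {ρ γ c : ℝ} {ν σ : Fin N → ℝ} (hρ : 0 < ρ) (hσ : ∀ i, 0 < σ i) :
    Filter.Tendsto (comparison N ρ γ c ν σ) Filter.atTop (nhds (N * γ / ρ)) := by
  have hexp : ∀ a : ℝ, 0 < a →
      Filter.Tendsto (fun t => Real.exp (-a * t)) Filter.atTop (nhds 0) := fun a ha =>
    Real.tendsto_exp_atBot.comp (Filter.tendsto_id.const_mul_atTop_of_neg (neg_lt_zero.2 ha))
  have h := ((tendsto_finsetSum Finset.univ fun i _ =>
    (hexp (σ i) (hσ i)).const_mul (ν i / (ρ - σ i))).const_add (N * γ / ρ)).add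
    ((hexp ρ hρ).const_mul c)
  simp only [mul_zero, Finset.sum_const_zero, add_zero] at h
  exact h

end Comparison

/-! ### Runs of the closed loop before the horizon -/

theorem hasDerivWithinAt_lyapunov {Y : Matrix (Fin n) (Fin n) ℝ} (hY : Y.PosDef)
    (ϑ : Fin N → ℝ) {z : Fin N → ℝ → EuclideanSpace ℝ (Fin n)}
    {z' : Fin N → EuclideanSpace ℝ (Fin n)} {s : Set ℝ} {t : ℝ}
    (hz : ∀ i, HasDerivWithinAt (z i) (z' i) s t) :
    HasDerivWithinAt (fun t => lyapunov Y ϑ fun i => z i t)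
      (2 * ∑ i, (ϑ i)⁻¹ * inner ℝ (Matrix.toEuclideanLin Y (z i t)) (z' i)) s t := by
  have hYt : Yᵀ = Y := by simpa using hY.1.eq
  have hd := HasDerivWithinAt.fun_sum (u := Finset.univ) fun i _ =>
    ((hz i).inner ℝ ((Matrix.toEuclideanLin Y).toContinuousLinearMap.hasFDerivAt.comp_hasDerivWithinAt
      t (hz i))).const_mul (ϑ i)⁻¹
  refine hd.congr_deriv ?_
  rw [Finset.mul_sum]
  refine Finset.sum_congr rfl fun i _ => ?_
  simp only [LinearMap.coe_toContinuousLinearMap', Function.comp_apply]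
  rw [inner_toEuclideanLin, hYt, real_inner_comm (Matrix.toEuclideanLin Y (z i t)) (z' i),
    inner_toEuclideanLin, hYt]
  ring

theorem le_triggerLevel {net : Network N} {Y : Matrix (Fin n) (Fin n) ℝ} {ϑ : Fin N → ℝ}
    {ω γ : ℝ} {μ ν σ : Fin N → ℝ} (hY : Y.PosDef) (hα : 0 ≤ net.alpha ϑ) (hω : 0 ≤ ω)
    (hϑ : ∀ i, 0 < ϑ i) (hμ : ∀ i, 0 < μ i) (hν : ∀ i, 0 < ν i) (i : Fin N) (t : ℝ)
    (z : EuclideanSpace ℝ (Fin n)) :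
    net.alpha ϑ * ω * γ ≤ triggerLevel net Y ϑ ω μ ν σ γ i t z := by
  have h1 := inner_toEuclideanLin_nonneg hY.posSemidef z
  have h2 := inv_pos.2 (hϑ i)
  have h3 := hμ i
  have h4 := hν i
  rw [triggerLevel]
  refine mul_le_mul_of_nonneg_left ?_ (by positivity)
  have : 0 ≤ μ i * (ϑ i)⁻¹ * inner ℝ z (Matrix.toEuclideanLin Y z) +
    ν i * Real.exp (-σ i * t) := by positivity
  linarith

namespace IsRun

variable {net : Network N} {A : Matrix (Fin n) (Fin n) ℝ} {B : Matrix (Fin n) (Fin p) ℝ}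
  {K : Matrix (Fin p) (Fin n) ℝ} {level : Fin N → ℝ → EuclideanSpace ℝ (Fin n) → ℝ}
  {x₀ : ℝ → EuclideanSpace ℝ (Fin n)} {x : Fin N → ℝ → EuclideanSpace ℝ (Fin n)}
  {τ : Fin N → ℕ → EReal}

theorem event_le_succ (h : IsRun net A B K level x₀ x τ) (i : Fin N) (k : ℕ) :
    τ i k ≤ τ i (k + 1) := by
  rw [h.event_succ]
  refine le_sInf ?_
  rintro _ ⟨t, rfl, ht, _⟩
  exact ht.le

theorem event_nonneg (h : IsRun net A B K level x₀ x τ) (i : Fin N) (k : ℕ) : 0 ≤ τ i k := by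
  induction k with
  | zero => rw [h.event_zero]
  | succ k ih => exact ih.trans (h.event_le_succ i k)

/-- With a nonpositive horizon no event after time 0 is admissible, so each `τ i 1` is the infimum
of the empty set, and the horizon would be `⊤`. -/
theorem horizon_pos (h : IsRun net A B K level x₀ x τ) : 0 < horizon τ := by
  by_contra! hle
  have htop : ∀ i, τ i 1 = ⊤ := fun i => by
    rw [h.event_succ]
    refine sInf_eq_top.2 ?_
    rintro _ ⟨t, _, ht, ht', _⟩
    rw [h.event_zero] at ht
    exact absurd (ht.trans ht') (not_lt.2 hle)
  have : horizon τ = ⊤ := by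
    refine iInf_eq_top.2 fun i => top_le_iff.1 ?_
    exact (htop i).ge.trans (le_iSup (τ i) 1)
  simp [this] at hle

theorem exists_between_events (h : IsRun net A B K level x₀ x τ) (i : Fin N) {t : ℝ} (ht : 0 ≤ t)
    (ht' : (t : EReal) < horizon τ) : ∃ k, τ i k ≤ t ∧ (t : EReal) < τ i (k + 1) := by
  classical
  -- The horizon is at most the supremum of the events of i, so some event lies after t; the index
  -- sought precedes the first such event.
  have hex : ∃ k, (t : EReal) < τ i k := lt_iSup_iff.1 (ht'.trans_le (iInf_le _ i))
  have hpos : Nat.find hex ≠ 0 := fun h0 => by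
    have := Nat.find_spec hex
    rw [h0, h.event_zero] at this
    exact absurd this (not_lt.2 (by exact_mod_cast ht))
  obtain ⟨k, hk⟩ := Nat.exists_eq_succ_of_ne_zero hpos
  refine ⟨k, not_lt.1 (Nat.find_min hex (by omega)), ?_⟩
  have := Nat.find_spec hex
  rwa [hk] at this

/-- An event time that is not after the finite time `t` is a real number in `[0, t]`. -/
theorem exists_event_eq_coe (h : IsRun net A B K level x₀ x τ) {i : Fin N} {k : ℕ} {t : ℝ}
    (hk : τ i k ≤ t) : ∃ r : ℝ, τ i k = r ∧ 0 ≤ r ∧ r ≤ t := by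
  have hbot : τ i k ≠ ⊥ := fun hb => by
    have := h.event_nonneg i k
    rw [hb] at this
    simp at this
  have htop : τ i k ≠ ⊤ := fun hb => by
    rw [hb] at hk
    simp at hk
  lift τ i k to ℝ using ⟨htop, hbot⟩ with r hr
  have h0 := h.event_nonneg i k
  rw [← hr] at h0
  exact ⟨r, rfl, by exact_mod_cast h0, by exact_mod_cast hk⟩

/-- The error vanishes at the event itself. A later violation would make t a candidate for the next
event, forcing `τ i (k + 1) ≤ t`. -/
theorem norm_error_sq_le (h : IsRun net A B K level x₀ x τ) (hlevel : ∀ i t z, 0 ≤ level i t z)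
    {i : Fin N} {k : ℕ} {t : ℝ} (hk : τ i k ≤ t) (hk' : (t : EReal) < τ i (k + 1))
    (ht' : (t : EReal) < horizon τ) :
    ‖net.combState x₀ x i (τ i k).toReal - net.combState x₀ x i t‖ ^ 2 ≤
      level i t (net.combState x₀ x i t) := by
  rcases hk.eq_or_lt with heq | hlt
  · simp [heq, hlevel]
  · by_contra! hcon
    refine absurd hk' (not_lt.2 ?_)
    rw [h.event_succ]
    exact sInf_le ⟨t, rfl, hlt, ht', hcon.le⟩

theorem Icc_subset {b : ℝ} (hb : (b : EReal) < horizon τ) :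
    Set.Icc 0 b ⊆ {t : ℝ | 0 ≤ t ∧ (t : EReal) < horizon τ} := fun _ ht =>
  ⟨ht.1, lt_of_le_of_lt (by exact_mod_cast ht.2) hb⟩

theorem continuousOn_combState (h : IsRun net A B K level x₀ x τ) (i : Fin N) :
    ContinuousOn (net.combState x₀ x i) {t : ℝ | 0 ≤ t ∧ (t : EReal) < horizon τ} := by
  have : net.combState x₀ x i = fun t => ∑ j, net.coupling i j • (x₀ t - x j t) :=
    funext fun t => net.combState_eq x₀ x i t
  rw [this]
  exact continuousOn_finsetSum _ fun j _ =>
    ContinuousOn.fun_const_smul (h.leader_continuous.fun_sub (h.follower_continuous j)) _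

theorem hasDerivWithinAt_combState (h : IsRun net A B K level x₀ x τ) {t : ℝ} (ht : 0 ≤ t)
    (ht' : (t : EReal) < horizon τ) {k : Fin N → ℕ} (hk : ∀ j, τ j (k j) ≤ t)
    (hk' : ∀ j, (t : EReal) < τ j (k j + 1)) (i : Fin N) :
    HasDerivWithinAt (net.combState x₀ x i)
      (Matrix.toEuclideanLin A (net.combState x₀ x i t) -
        ∑ j, net.coupling i j • Matrix.toEuclideanLin B
          (-Matrix.toEuclideanLin K (net.combState x₀ x j (τ j (k j)).toReal)))
      (Set.Ici t) t := by
  have hfun : net.combState x₀ x i = fun t => ∑ j, net.coupling i j • (x₀ t - x j t) :=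
    funext fun t => net.combState_eq x₀ x i t
  have hd := HasDerivWithinAt.fun_sum (u := Finset.univ) fun j _ =>
    ((h.leader_deriv t ht ht').sub
      (h.follower_deriv j (k j) t (hk j) (hk' j) ht')).const_smul (net.coupling i j)
  rw [hfun]
  refine hd.congr_deriv ?_
  rw [map_sum, ← Finset.sum_sub_distrib]
  refine Finset.sum_congr rfl fun j _ => ?_
  rw [map_smul, map_sub, ← smul_sub, sub_add_eq_sub_sub]

theorem continuousOn_lyapunov (h : IsRun net A B K level x₀ x τ) (Y : Matrix (Fin n) (Fin n) ℝ)
    (ϑ : Fin N → ℝ) :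
    ContinuousOn (fun t => lyapunov Y ϑ fun i => net.combState x₀ x i t)
      {t : ℝ | 0 ≤ t ∧ (t : EReal) < horizon τ} := by
  refine continuousOn_finsetSum _ fun i _ => ContinuousOn.mul continuousOn_const ?_
  exact (h.continuousOn_combState i).inner ((LinearMap.continuous_of_finiteDimensional
    (Matrix.toEuclideanLin Y)).comp_continuousOn (h.continuousOn_combState i))

end IsRun

/-! ### Minimal inter-event time and exclusion of Zeno behaviour -/

theorem exists_norm_vectorField_le (M : Matrix (Fin N) (Fin N) ℝ) (A : Matrix (Fin n) (Fin n) ℝ)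
    (B : Matrix (Fin n) (Fin p) ℝ) (K : Matrix (Fin p) (Fin n) ℝ) {C : ℝ} (hC : 0 ≤ C) :
    ∃ L, 0 ≤ L ∧ ∀ (i : Fin N) (v : EuclideanSpace ℝ (Fin n))
      (u : Fin N → EuclideanSpace ℝ (Fin n)), ‖v‖ ≤ C → (∀ j, ‖u j‖ ≤ C) →
      ‖Matrix.toEuclideanLin A v - ∑ j, M i j • Matrix.toEuclideanLin B
        (-Matrix.toEuclideanLin K (u j))‖ ≤ L := by
  set a := (Matrix.toEuclideanLin A).toContinuousLinearMap
  set b := (Matrix.toEuclideanLin B ∘ₗ (-Matrix.toEuclideanLin K)).toContinuousLinearMap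
  -- Summing over all rows makes the constant independent of the agent.
  refine ⟨‖a‖ * C + ∑ i, ∑ j, ‖M i j‖ * (‖b‖ * C), by positivity, fun i v u hv hu => ?_⟩
  refine (norm_sub_le _ _).trans (add_le_add ?_ ?_)
  · exact (a.le_opNorm v).trans (by gcongr)
  · calc _ ≤ ∑ j, ‖M i j • b (u j)‖ := norm_sum_le _ _
      _ ≤ ∑ j, ‖M i j‖ * (‖b‖ * C) := by
        refine Finset.sum_le_sum fun j _ => ?_
        rw [norm_smul]
        gcongr
        exact (b.le_opNorm _).trans (by gcongr; exact hu j)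
      _ ≤ _ := Finset.single_le_sum (f := fun i => ∑ j, ‖M i j‖ * (‖b‖ * C))
        (fun i _ => by positivity) (Finset.mem_univ i)

namespace IsRun

section

variable {net : Network N} {A : Matrix (Fin n) (Fin n) ℝ} {B : Matrix (Fin n) (Fin p) ℝ}
  {K : Matrix (Fin p) (Fin n) ℝ} {level : Fin N → ℝ → EuclideanSpace ℝ (Fin n) → ℝ}
  {x₀ : ℝ → EuclideanSpace ℝ (Fin n)} {x : Fin N → ℝ → EuclideanSpace ℝ (Fin n)}
  {τ : Fin N → ℕ → EReal}

/-- A run with bounded combinational states, whose trigger level is bounded below by a positive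
constant, has a positive minimal inter-event time. -/
theorem exists_minimal_interEvent_time (h : IsRun net A B K level x₀ x τ) {c C : ℝ} (hc : 0 < c)
    (hlevel : ∀ i t z, c ≤ level i t z)
    (hC : ∀ i (t : ℝ), 0 ≤ t → (t : EReal) < horizon τ → ‖net.combState x₀ x i t‖ ≤ C) :
    ∃ δ : ℝ, 0 < δ ∧ ∀ i k, τ i k + (δ : EReal) ≤ τ i (k + 1) := by
  rcases isEmpty_or_nonempty (Fin N) with hN | ⟨⟨i₀⟩⟩
  · exact ⟨1, one_pos, fun i => hN.elim i⟩
  have hC0 : 0 ≤ C :=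
    (norm_nonneg _).trans (hC i₀ 0 le_rfl (by simpa using h.horizon_pos))
  obtain ⟨L, hL, hbound⟩ := exists_norm_vectorField_le net.coupling A B K hC0
  -- The error grows at rate at most L and must reach √c; the added 1 covers L = 0.
  refine ⟨√c / (L + 1), by positivity, fun i k => ?_⟩
  rw [h.event_succ]
  refine le_sInf ?_
  rintro _ ⟨t, rfl, hkt, ht', hev⟩
  obtain ⟨r, hr, hr0, hrt⟩ := h.exists_event_eq_coe hkt.le
  rw [hr, EReal.toReal_coe] at hev
  rw [hr, ← EReal.coe_add, EReal.coe_le_coe_iff]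
  have hder : ∀ q ∈ Set.Ico r t, ∃ d, HasDerivWithinAt (net.combState x₀ x i) d (Set.Ici q) q ∧
      ‖d‖ ≤ L := by
    intro q hq
    have hq0 : 0 ≤ q := hr0.trans hq.1
    have hq' : (q : EReal) < horizon τ := lt_trans (by exact_mod_cast hq.2) ht'
    -- Other agents may have events inside [r, t), so each has its own current index at q. Held
    -- values are earlier values of z, hence also bounded by C.
    choose l hl hl' using fun j => h.exists_between_events j hq0 hq'
    refine ⟨_, h.hasDerivWithinAt_combState hq0 hq' hl hl' i,
      hbound i _ _ (hC i q hq0 hq') fun j => ?_⟩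
    obtain ⟨e, he, he0, heq⟩ := h.exists_event_eq_coe (hl j)
    rw [he, EReal.toReal_coe]
    exact hC j e he0 (lt_of_le_of_lt (by exact_mod_cast heq) hq')
  choose! d hd hdL using hder
  have hlip := norm_image_sub_le_of_norm_deriv_right_le_segment
    ((h.continuousOn_combState i).mono
      ((Set.Icc_subset_Icc_left hr0).trans (Icc_subset ht'))) hd hdL t (Set.right_mem_Icc.2 hrt)
  have hsqrt : √c ≤ ‖net.combState x₀ x i t - net.combState x₀ x i r‖ := by
    rw [norm_sub_rev]
    exact Real.sqrt_le_iff.2 ⟨norm_nonneg _, (hlevel i t _).trans hev⟩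
  have : √c / (L + 1) ≤ t - r := by
    rw [div_le_iff₀ (by positivity)]
    nlinarith
  linarith

theorem horizon_eq_top (h : IsRun net A B K level x₀ x τ) {δ : ℝ} (hδ : 0 < δ)
    (hτ : ∀ i k, τ i k + (δ : EReal) ≤ τ i (k + 1)) : horizon τ = ⊤ := by
  refine iInf_eq_top.2 fun i => ?_
  have hk : ∀ k : ℕ, ((k * δ : ℝ) : EReal) ≤ τ i k := by
    intro k
    induction k with
    | zero => simp [h.event_zero]
    | succ k ih =>
      refine le_trans ?_ (hτ i k)
      refine le_trans (le_of_eq ?_) (add_le_add_left ih _)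
      rw [← EReal.coe_add, Nat.cast_succ, add_mul, one_mul]
  refine EReal.eq_top_iff_forall_lt _ |>.2 fun y => ?_
  obtain ⟨k, hky⟩ := exists_nat_gt (y / δ)
  rw [div_lt_iff₀ hδ] at hky
  exact lt_of_lt_of_le (by exact_mod_cast hky) ((hk k).trans (le_iSup (τ i) k))

end

variable {net : Network N} {A : Matrix (Fin n) (Fin n) ℝ} {B : Matrix (Fin n) (Fin p) ℝ}
  {R : Matrix (Fin p) (Fin p) ℝ} {Q Y : Matrix (Fin n) (Fin n) ℝ} {ϑ : Fin N → ℝ}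
  {ω γ : ℝ} {μ ν σ : Fin N → ℝ}
  {x₀ : ℝ → EuclideanSpace ℝ (Fin n)} {x : Fin N → ℝ → EuclideanSpace ℝ (Fin n)}
  {τ : Fin N → ℕ → EReal}

theorem lyapunov_le_comparison [Nonempty (Fin n)] [Nonempty (Fin N)] (hR : R.PosDef)
    (hQ : Q.PosDef) (hϑ : ∀ i, 0 < ϑ i) (hH : (net.matH ϑ).PosDef) (hY : Y.PosDef)
    (hric : Riccati A B R Q Y ϑ) (hω : 0 < ω) (hγ : 0 < γ) (hμ : ∀ i, 0 < μ i)
    (hν : ∀ i, 0 < ν i) (hρ : 0 < ⨅ i, rho net B R Q Y ϑ ω μ i)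
    (hσ : ∀ i, 0 < σ i ∧ σ i < ⨅ j, rho net B R Q Y ϑ ω μ j)
    (h : IsRun net A B (gain net B R Y ϑ) (triggerLevel net Y ϑ ω μ ν σ γ) x₀ x τ)
    {t : ℝ} (ht : 0 ≤ t) (ht' : (t : EReal) < horizon τ) :
    lyapunov Y ϑ (fun i => net.combState x₀ x i t) ≤
      comparison N (⨅ i, rho net B R Q Y ϑ ω μ i) γ
        (lyapunov Y ϑ fun i => net.combState x₀ x i 0) ν σ t := by
  have hα := Network.alpha_pos hH
  have hlevel : ∀ i t z, 0 ≤ triggerLevel net Y ϑ ω μ ν σ γ i t z := fun i t z =>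
    le_trans (by positivity) (le_triggerLevel hY hα.le hω.le hϑ hμ hν i t z)
  have hder : ∀ q ∈ Set.Ico 0 t, ∃ d, HasDerivWithinAt
      (fun t => lyapunov Y ϑ fun i => net.combState x₀ x i t) d (Set.Ici q) q ∧
      d ≤ -(⨅ i, rho net B R Q Y ϑ ω μ i) * lyapunov Y ϑ (fun i => net.combState x₀ x i q) +
        (N * γ + ∑ i, ν i * Real.exp (-σ i * q)) := by
    intro q hq
    have hq' : (q : EReal) < horizon τ := lt_trans (by exact_mod_cast hq.2) ht'
    choose l hl hl' using fun j => h.exists_between_events j hq.1 hq'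
    refine ⟨_, hasDerivWithinAt_lyapunov hY ϑ
      fun i => h.hasDerivWithinAt_combState hq.1 hq' hl hl' i, ?_⟩
    have := lyapunov_deriv_le_of_trigger hR hQ hϑ hH hY hric hω
      (fun i => net.combState x₀ x i q)
      (fun i => net.combState x₀ x i (τ i (l i)).toReal - net.combState x₀ x i q)
      fun i => h.norm_error_sq_le hlevel (hl i) (hl' i) hq'
    simpa only [add_sub_cancel] using this
  choose! d hd hdle using hder
  refine le_comparison hρ.ne' (fun i => (sub_pos.2 (hσ i).2).ne') ht
    ((h.continuousOn_lyapunov Y ϑ).mono (Icc_subset ht')) hd hdle ?_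
  -- The constant c = V(0) already gives W(0) ≥ V(0), because the other terms of W(0) are
  -- nonnegative.
  have h1 : 0 ≤ ∑ i, ν i / ((⨅ i, rho net B R Q Y ϑ ω μ i) - σ i) * Real.exp (-σ i * 0) :=
    Finset.sum_nonneg fun i _ =>
      mul_nonneg (div_pos (hν i) (sub_pos.2 (hσ i).2)).le (Real.exp_pos _).le
  have h2 : 0 ≤ N * γ / ⨅ i, rho net B R Q Y ϑ ω μ i := by positivity
  rw [comparison]
  simp only [mul_zero, Real.exp_zero, mul_one] at h1 ⊢
  linarith

end IsRun

end EventTracking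
end

/-! ### The tracking bound -/

theorem theorem1 {N n p : ℕ} (hn : 0 < n)
    (net : EventTracking.Network N) (hnet : net.HasPinnedSpanningTree)
    (A : Matrix (Fin n) (Fin n) ℝ) (B : Matrix (Fin n) (Fin p) ℝ)
    (R : Matrix (Fin p) (Fin p) ℝ) (Q : Matrix (Fin n) (Fin n) ℝ)
    (hR : R.PosDef) (hQ : Q.PosDef) :
    (∃ ϑ : Fin N → ℝ, (∀ i, 0 < ϑ i) ∧ (net.matH ϑ).PosDef) ∧
    ∀ ϑ : Fin N → ℝ, (∀ i, 0 < ϑ i) → (net.matH ϑ).PosDef →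
    ∀ Y : Matrix (Fin n) (Fin n) ℝ, Y.PosDef → EventTracking.Riccati A B R Q Y ϑ →
    ∀ (ω γ : ℝ) (μ ν σ : Fin N → ℝ), 0 < ω → 0 < γ → (∀ i, 0 < μ i) → (∀ i, 0 < ν i) →
    (∀ i, 0 < EventTracking.rho net B R Q Y ϑ ω μ i) →
    (∀ i, 0 < σ i ∧ σ i < ⨅ j, EventTracking.rho net B R Q Y ϑ ω μ j) →
    ∀ (x₀ : ℝ → EuclideanSpace ℝ (Fin n)) (x : Fin N → ℝ → EuclideanSpace ℝ (Fin n))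
      (τ : Fin N → ℕ → EReal),
    EventTracking.IsRun net A B (EventTracking.gain net B R Y ϑ)
      (EventTracking.triggerLevel net Y ϑ ω μ ν σ γ) x₀ x τ →
    (∃ δ : ℝ, 0 < δ ∧ ∀ i k, τ i k + (δ : EReal) ≤ τ i (k + 1)) ∧
    EventTracking.horizon τ = ⊤ ∧
    Filter.limsup (fun t : ℝ => ((∑ i, ‖x₀ t - x i t‖ ^ 2 : ℝ) : EReal)) Filter.atTop ≤
      ((N * γ / ((⨅ i, (ϑ i)⁻¹) * EventTracking.lambdaMin Y *
        EventTracking.lambdaMin net.matF *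
        ⨅ i, EventTracking.rho net B R Q Y ϑ ω μ i) : ℝ) : EReal) := by
  open EventTracking in
  refine ⟨hnet.exists_matH_posDef, ?_⟩
  intro ϑ hϑ hH Y hY hric ω γ μ ν σ hω hγ hμ hν hrho hσ x₀ x τ hrun
  have : Nonempty (Fin n) := ⟨⟨0, hn⟩⟩
  have : Nonempty (Fin N) := ⟨hnet.choose⟩
  have hα := Network.alpha_pos hH
  have hρ := iInf_fin_pos hrho
  have hc : 0 < (⨅ i, (ϑ i)⁻¹) * lambdaMin Y :=
    mul_pos (iInf_fin_pos fun i => inv_pos.2 (hϑ i)) (lambdaMin_pos hY)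
  have hF := lambdaMin_pos (Network.matF_posDef hnet)
  have hV := fun {t : ℝ} => hrun.lyapunov_le_comparison (t := t) hR hQ hϑ hH hY hric hω hγ hμ hν hρ hσ
  have hV0 : 0 ≤ lyapunov Y ϑ fun i => net.combState x₀ x i 0 :=
    le_trans (by positivity) (mul_sum_norm_sq_le_lyapunov hY hϑ _)
  set ρ := ⨅ i, rho net B R Q Y ϑ ω μ i
  set W := comparison N ρ γ (lyapunov Y ϑ fun i => net.combState x₀ x i 0) ν σ
  have hz : ∀ t : ℝ, 0 ≤ t → (t : EReal) < horizon τ →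
      ∑ i, ‖net.combState x₀ x i t‖ ^ 2 ≤ W t / ((⨅ i, (ϑ i)⁻¹) * lambdaMin Y) := by
    intro t ht ht'
    rw [le_div_iff₀' hc]
    exact (mul_sum_norm_sq_le_lyapunov hY hϑ _).trans (hV ht ht')
  -- As W is at most W(0), the bound C holds on the whole interval before the horizon, without
  -- knowing that it is infinite.
  obtain ⟨δ, hδ, hτ⟩ := hrun.exists_minimal_interEvent_time
    (c := net.alpha ϑ * ω * γ) (C := √(W 0 / ((⨅ i, (ϑ i)⁻¹) * lambdaMin Y))) (by positivity)
    (le_triggerLevel hY hα.le hω.le hϑ hμ hν) fun i t ht ht' => by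
      refine Real.le_sqrt_of_sq_le ?_
      calc ‖net.combState x₀ x i t‖ ^ 2 ≤ ∑ i, ‖net.combState x₀ x i t‖ ^ 2 :=
            Finset.single_le_sum (f := fun i => ‖net.combState x₀ x i t‖ ^ 2)
              (fun i _ => by positivity) (Finset.mem_univ i)
        _ ≤ _ := hz t ht ht'
        _ ≤ _ := by
          gcongr
          exact comparison_le hρ hσ hν hV0 ht
  have htop := hrun.horizon_eq_top hδ hτ
  refine ⟨⟨δ, hδ, hτ⟩, htop, ?_⟩
  have hlim : Filter.Tendsto (fun t => W t / ((⨅ i, (ϑ i)⁻¹) * lambdaMin Y) / lambdaMin net.matF)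
      Filter.atTop (nhds (N * γ / ((⨅ i, (ϑ i)⁻¹) * lambdaMin Y * lambdaMin net.matF * ρ))) := by
    have hT := ((tendsto_comparison (γ := γ) (c := lyapunov Y ϑ fun i => net.combState x₀ x i 0)
      (ν := ν) hρ fun i => (hσ i).1).div_const ((⨅ i, (ϑ i)⁻¹) * lambdaMin Y)).div_const
      (lambdaMin net.matF)
    convert hT using 2
    rw [div_div, div_div]
    congr 1
    ring
  rw [← ((continuous_coe_real_ereal.tendsto _).comp hlim).limsup_eq]
  refine Filter.limsup_le_limsup ?_
  filter_upwards [Filter.eventually_ge_atTop 0] with t ht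
  have ht' : (t : EReal) < horizon τ := htop ▸ EReal.coe_lt_top t
  refine EReal.coe_le_coe_iff.2 ?_
  rw [le_div_iff₀' hF]
  exact (Network.lambdaMin_matF_mul_le x₀ x t).trans (hz t ht ht')
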